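/- For a group $G$ let $\mathbb{T}_G=\operatorname{Hom}(G,\mathbb{C}^*)$ be its group of complex characters. For $\rho\in\mathbb{T}_G$ let $\mathbb{C}_\rho$ be the $G$-module $\mathbb{C}$ on which $g\in G$ acts as multiplication by $\rho(g)$. For integers $s,t\ge 0$ put $$\mathcal{V}^s_t(G)=\{\rho\in\mathbb{T}_G \mid \dim_{\mathbb{C}} H_s(G,\mathbb{C}_\rho)\ge t\}.$$ A group $G$ is of type $FP_n$ if the trivial $\mathbb{Z}G$-module $\mathbb{Z}$ has a resolution by projective $\mathbb{Z}G$-modules which are finitely generated in all degrees $\le n$. Two groups $G$ and $G'$ are commensurable up to finite kernels if they can be connected by a finite zig-zag of diagrams of the form $G_1\leftarrow\pi\rightarrow G_2$, where $\pi$ is a group and both arrows are homomorphisms with finite kernel and with image of finite index. **Theorem.** Let $G$ be a finitely generated group, let $\nu\colon G\to A$ be a non-trivial homomorphism to a torsion-free abelian group $A$, and let $N=\ker(\nu)$. If $\mathcal{V}^r_1(G)=\mathbb{T}_G$ for some integer $r\ge 1$, then: 1. $\dim_{\mathbb{C}} H_{\le r}(N,\mathbb{C})=\infty$, where $H_{\le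 r}(N,\mathbb{C})=\bigoplus_{i=0}^{r}H_i(N,\mathbb{C})$ and $N$ acts trivially on $\mathbb{C}$. 2. $N$ is not commensurable up to finite kernels to any group of type $FP_r$. -/

import Mathlib

open CategoryTheory

noncomputable section

/-- The one-dimensional complex representation of `G` attached to a character `ρ : G →* ℂˣ`:
an element `g` acts on `ℂ` by multiplication by `ρ g`. -/
def characterRepresentation {G : Type} [Group G] (ρ : G →* ℂˣ) : Representation ℂ G ℂ :=
  (algebraMap ℂ (Module.End ℂ ℂ) : ℂ →* Module.End ℂ ℂ).comp ((Units.coeHom ℂ).comp ρ)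

theorem characterRepresentation_apply {G : Type} [Group G] (ρ : G →* ℂˣ) (g : G) (z : ℂ) :
    characterRepresentation ρ g z = (ρ g : ℂ) * z := rfl

/-- The `G`-module `ℂ_ρ`. -/
abbrev characterRep {G : Type} [Group G] (ρ : G →* ℂˣ) : Rep.{0} ℂ G :=
  Rep.of (characterRepresentation ρ)

/-- The characteristic variety `V^s_t(G)`: the set of characters `ρ` in the character torus
`Hom(G, ℂˣ)` with `dim_ℂ H_s(G, ℂ_ρ) ≥ t`. The dimension is a cardinal, as it may be infinite. -/
def characteristicVariety (G : Type) [Group G] (s t : ℕ) : Set (G →* ℂˣ) :=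
  {ρ | (t : Cardinal.{0}) ≤ Module.rank ℂ (groupHomology (characterRep ρ) s)}

/-- The graded complex vector space `H_{≤ r}(N, ℂ) = ⨁_{i ≤ r} H_i(N, ℂ)`, where `ℂ` has the
trivial action of `N`. -/
abbrev homologyUpTo (N : Type) [Group N] (r : ℕ) : Type :=
  DirectSum (Fin (r + 1)) fun i => groupHomology (Rep.trivial ℂ N ℂ) (i : ℕ)

/-- The trivial `ℤ[G]`-module `ℤ`. -/
abbrev trivialIntModule (G : Type) [Group G] : ModuleCat.{0} (MonoidAlgebra ℤ G) :=
  ModuleCat.of (MonoidAlgebra ℤ G) (Representation.trivial ℤ G ℤ).asModule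

/-- `G` is of type `FP_n`: the trivial module `ℤ` has a resolution by projective `ℤ[G]`-modules
which is finitely generated in all degrees `≤ n`. -/
def IsOfTypeFP (G : Type) [Group G] (n : ℕ) : Prop :=
  ∃ P : ProjectiveResolution (trivialIntModule G),
    ∀ i ≤ n, Module.Finite (MonoidAlgebra ℤ G) (P.complex.X i)

/-- A homomorphism with finite kernel and with image of finite index. -/
def HasFiniteKernelAndCofiniteImage {π G : Type} [Group π] [Group G] (f : π →* G) : Prop :=
  Finite f.ker ∧ f.range.FiniteIndex

/-- `G` and `G'` are the feet of a diagram `G ← π → G'` whose two arrows have finite kernel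
and image of finite index. -/
def IsCommensurabilityStep (G G' : GrpCat.{0}) : Prop :=
  ∃ (π : GrpCat.{0}) (f : π →* G) (f' : π →* G'),
    HasFiniteKernelAndCofiniteImage f ∧ HasFiniteKernelAndCofiniteImage f'

/-- `G` and `G'` are commensurable up to finite kernels: they are connected by a finite
zig-zag of diagrams `G ← π → G'` whose arrows have finite kernel and image of finite index. -/
def CommensurableUpToFiniteKernels (G G' : Type) [Group G] [Group G'] : Prop :=
  Relation.TransGen IsCommensurabilityStep (GrpCat.of G) (GrpCat.of G')

end

/-! Suppose `H_i(N, ℂ)` is finite-dimensional for all `i ≤ r`. The image of `ν` is `ℤⁿ` with `n ≥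
1`, and Shapiro's lemma gives `H_i(N, ℂ) = H_i(G, ℂ[ℤⁿ])`. For one factor `ℤ` with generator `t`,
the sequence `0 → k[ℤ] ⊗ V → k[ℤ] ⊗ V → V_c → 0` with first map `t - c` is exact
(`wangComplex_shortExact`). If `c ≠ 0` avoids the finitely many eigenvalues of `t` on homology up to
degree `r`, then `t - c` is bijective there, so `H_i(G, V_c) = 0` for `i ≤ r`. Peeling off the
factors of `ℤⁿ` one by one (`HasAcyclicTwists.prod`) yields a character `ρ` with `H_i(G, ℂ_ρ) = 0`
for `i ≤ r`, against the hypothesis in degree `r`.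

For the second claim, type `FP_r` forces finite-dimensional homology up to degree `r` with all
finite-dimensional complex coefficients. That property passes along commensurability in both
directions, so it would hold for `N`. -/

/-! ### Shapiro's lemma for homomorphisms with finite kernel -/

namespace Rep

open Representation

variable {k : Type} [Field k] [CharZero k] {G H : Type} [Group G] [Group H]

/-- In characteristic zero, coinduction along a homomorphism with finite kernel preserves
epimorphisms. -/
theorem coindFunctor_preservesEpimorphisms_of_finite_ker (φ : G →* H) [Finite φ.ker] :
    (coindFunctor.{0} k φ).PreservesEpimorphisms where
  preserves {X Y} f _ := (epi_iff_surjective _).2 fun y => by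
    have := Fintype.ofFinite φ.ker
    choose s hs using (Rep.epi_iff_surjective f).1 ‹_›
    let rel := QuotientGroup.rightRel φ.range
    choose i hi using Quotient.mk'_surjective (s := rel)
    have hmk (g : G) (h : H) : (Quotient.mk' (φ g * h) : Quotient rel) = Quotient.mk' h :=
      Quotient.eq'.2 (QuotientGroup.rightRel_apply.2 (by simp))
    have hex (h : H) : ∃ g : G, φ g * i (Quotient.mk' h) = h := by
      obtain ⟨g, hg⟩ := QuotientGroup.rightRel_apply.1 (Quotient.eq'.1 (hi (Quotient.mk' h)))
      exact ⟨g, by rw [hg]; group⟩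
    choose γ hγ using hex
    -- `γ h` is determined only up to `φ.ker`; averaging over the kernel makes the lift below
    -- independent of that choice.
    let avg (x : X) : X := (Fintype.card φ.ker : k)⁻¹ • ∑ u : φ.ker, X.ρ u x
    have havg (u : G) (hu : φ u = 1) (x : X) : X.ρ u (avg x) = avg x := by
      simp only [avg, map_smul, map_sum]
      congr 1
      refine Fintype.sum_equiv (Equiv.mulLeft (⟨u, hu⟩ : φ.ker)) _ _ fun v => ?_
      simp [Module.End.mul_apply]
    let x (h : H) : X := X.ρ (γ h) (avg (s (y.1 (i (Quotient.mk' h)))))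
    refine ⟨⟨x, fun g h => ?_⟩, Subtype.ext <| funext fun h => ?_⟩
    · have hu : φ ((g * γ h)⁻¹ * γ (φ g * h)) = 1 := by
        have h1 := hγ (φ g * h)
        rw [hmk] at h1
        have h2 : φ (γ (φ g * h)) = φ g * h * (i (Quotient.mk' h))⁻¹ :=
          eq_mul_inv_of_mul_eq h1
        have h3 : φ (γ h) = h * (i (Quotient.mk' h))⁻¹ := eq_mul_inv_of_mul_eq (hγ h)
        rw [map_mul, map_inv, map_mul, h2, h3]; group
      have h4 : γ (φ g * h) = g * γ h * ((g * γ h)⁻¹ * γ (φ g * h)) := by group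
      simp only [x, hmk]
      rw [h4, map_mul, Module.End.mul_apply, havg _ hu, map_mul, Module.End.mul_apply]
    -- Values of a coinduced function are fixed by the kernel, so averaging a preimage does not
    -- change its image.
    · have hy (u : φ.ker) (h : H) : Y.ρ u (y.1 h) = y.1 h := by
        rw [← y.2, (MonoidHom.mem_ker).1 u.2, one_mul]
      have hfa : f.hom (avg (s (y.1 (i (Quotient.mk' h))))) = y.1 (i (Quotient.mk' h)) := by
        simp only [avg, map_smul, map_sum, hom_comm_apply, hs, hy]
        rw [Finset.sum_const, Finset.card_univ, ← Nat.cast_smul_eq_nsmul k, smul_smul,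
          inv_mul_cancel₀ (Nat.cast_ne_zero.2 Fintype.card_ne_zero), one_smul]
      change f.hom (X.ρ (γ h) (avg (s (y.1 (i (Quotient.mk' h)))))) = y.1 h
      rw [hom_comm_apply, hfa, ← y.2, hγ]

/-- A left adjoint preserves projectives when its right adjoint, here coinduction, preserves
epimorphisms. -/
theorem resFunctor_preservesProjectiveObjects_of_finite_ker (φ : G →* H) [Finite φ.ker] :
    (resFunctor.{0} (k := k) φ).PreservesProjectiveObjects :=
  have := coindFunctor_preservesEpimorphisms_of_finite_ker (k := k) φ
  (resFunctor φ).preservesProjectiveObjects_of_adjunction_of_preservesEpimorphisms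
    (resCoindAdjunction k φ)

end Rep

namespace groupHomology

open Rep

/-- Shapiro's lemma for homomorphisms with finite kernel in characteristic zero. -/
noncomputable def indIsoOfFiniteKer {k : Type} [Field k] [CharZero k] {G H : Type} [Group G]
    [Group H] (φ : G →* H) [Finite φ.ker] (A : Rep.{0} k G) (n : ℕ) :
    groupHomology (ind φ A) n ≅ groupHomology A n := by
  classical
  have := resFunctor_preservesProjectiveObjects_of_finite_ker (k := k) φ
  let P := barResolution k H
  -- The restriction of `P` to `G` is still a projective resolution, and `(P ⊗ Ind A)_H ≅ (Res P ⊗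
  -- A)_G` computes both sides.
  exact (HomologicalComplex.homologyFunctor (ModuleCat k) (ComplexShape.down ℕ) n).mapIso
    (inhomogeneousChainsIso (ind φ A :) ≪≫
      (show ((resFunctor φ).mapProjectiveResolution P).complex.coinvariantsTensorObj A ≅
        P.complex.coinvariantsTensorObj (ind φ A) from
        (NatIso.mapHomologicalComplex (coinvariantsTensorIndNatIso φ A).symm _).app _).symm) ≪≫
    (groupHomologyIso A n ((resFunctor φ).mapProjectiveResolution P)).symm

end groupHomology

/-! ### Induction along homomorphisms with image of finite index -/

namespace Representation

variable {k G H V : Type*} [CommRing k] [Group G] [Group H] [AddCommGroup V] [Module k V]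

theorem IndV.mk_map_mul (φ : G →* H) (ρ : Representation k G V) (g : G) (h : H) (v : V) :
    IndV.mk φ ρ (φ g * h) (ρ g v) = IndV.mk φ ρ h v := by
  refine (Coinvariants.mk_eq_iff _).2 (Coinvariants.mem_ker_of_eq g (.single h 1 ⊗ₜ v) _ ?_)
  simp

/-- One copy of `V` for each coset of the image already surjects onto the induced module. -/
theorem finite_indV (φ : G →* H) [φ.range.FiniteIndex] (ρ : Representation k G V)
    [Module.Finite k V] : Module.Finite k (IndV φ ρ) := by
  have := Fintype.ofFinite (H ⧸ φ.range)
  let f : ((H ⧸ φ.range) → V) →ₗ[k] IndV φ ρ :=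
    ∑ q : H ⧸ φ.range, IndV.mk φ ρ q.out⁻¹ ∘ₗ LinearMap.proj q
  have hf : f.range.mkQ = 0 := by
    refine IndV.hom_ext φ ρ fun h => LinearMap.ext fun v => ?_
    classical
    simp only [LinearMap.comp_apply, Submodule.mkQ_apply, LinearMap.zero_apply]
    rw [Submodule.Quotient.mk_eq_zero]
    obtain ⟨⟨_, g, rfl⟩, hg⟩ := QuotientGroup.mk_out_eq_mul φ.range h⁻¹
    refine ⟨Pi.single (h⁻¹ : H) (ρ g⁻¹ v), ?_⟩
    have h1 : f (Pi.single ((h⁻¹ : H) : H ⧸ φ.range) (ρ g⁻¹ v)) =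
        IndV.mk φ ρ ((h⁻¹ : H) : H ⧸ φ.range).out⁻¹ (ρ g⁻¹ v) := by
      simp only [f, LinearMap.sum_apply, LinearMap.comp_apply, LinearMap.proj_apply]
      rw [Finset.sum_eq_single ((h⁻¹ : H) : H ⧸ φ.range)]
      · simp
      · intro b _ hb
        rw [Pi.single_eq_of_ne hb]
        simp
      · simp
    have h2 : ((h⁻¹ : H) : H ⧸ φ.range).out⁻¹ = φ g⁻¹ * h := by
      rw [hg]; simp
    rw [h1, h2, IndV.mk_map_mul]
    rfl
  refine Module.Finite.of_surjective f (LinearMap.range_eq_top.1 ?_)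
  rw [← Submodule.ker_mkQ f.range, hf, LinearMap.ker_zero]

end Representation

namespace Rep

open Representation

variable {k : Type} [Field k] {G H : Type} [Group G] [Group H]

/-- The counit of the adjunction between induction and restriction. -/
noncomputable def indResCounit (φ : G →* H) (M : Rep.{0} k H) : ind φ (res φ M) ⟶ M :=
  (indResHomEquiv.{0} φ (res φ M) M).symm (𝟙 (res φ M))

theorem indResCounit_mk (φ : G →* H) (M : Rep.{0} k H) (h : H) (m : M) :
    (indResCounit φ M).hom (IndV.mk φ (res φ M).ρ h m) = M.ρ h⁻¹ m := by
  simp [indResCounit]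

/-- The class in the induced representation of an element of `M` transported to a coset. -/
noncomputable def indResCoset (φ : G →* H) (M : Rep.{0} k H) :
    H ⧸ φ.range → M →ₗ[k] IndV φ (res φ M).ρ :=
  Quotient.lift (fun h => IndV.mk φ (res φ M).ρ h⁻¹ ∘ₗ M.ρ h⁻¹) fun a b hab => by
    obtain ⟨g, hg⟩ := QuotientGroup.leftRel_apply.1 hab
    have hb : b⁻¹ = φ g⁻¹ * a⁻¹ := by rw [map_inv, hg]; group
    ext m
    have := IndV.mk_map_mul φ (res φ M).ρ g⁻¹ a⁻¹ (M.ρ a⁻¹ m)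
    simp only [LinearMap.comp_apply, hb, map_mul, Module.End.mul_apply]
    exact this.symm

theorem indResCoset_mk (φ : G →* H) (M : Rep.{0} k H) (h : H) (m : M) :
    indResCoset φ M h m = IndV.mk φ (res φ M).ρ h⁻¹ (M.ρ h⁻¹ m) := rfl

theorem indResCoset_smul (φ : G →* H) (M : Rep.{0} k H) (h : H) (q : H ⧸ φ.range) (m : M) :
    indResCoset φ M (h • q) (M.ρ h m) = (ind φ (res φ M)).ρ h (indResCoset φ M q m) := by
  induction q using QuotientGroup.induction_on with
  | H x =>
    rw [indResCoset_mk]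
    refine Eq.trans ?_ (ind_mk φ (res φ M).ρ h x⁻¹ _).symm
    change indResCoset φ M ((h * x : H) : H ⧸ φ.range) _ = _
    rw [indResCoset_mk, mul_inv_rev, ← Module.End.mul_apply, ← map_mul, inv_mul_cancel_right]

variable [CharZero k]

/-- The averaged section of the counit of the adjunction between induction and restriction. -/
noncomputable def indResSection (φ : G →* H) [φ.range.FiniteIndex] (M : Rep.{0} k H) :
    M ⟶ ind φ (res φ M) :=
  letI := Fintype.ofFinite (H ⧸ φ.range)
  Rep.ofHom (LinearMap.intertwiningMap_of_isIntertwiningMap _ _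
    ((Fintype.card (H ⧸ φ.range) : k)⁻¹ • ∑ q : H ⧸ φ.range, indResCoset φ M q) fun h m => by
      simp only [LinearMap.smul_apply, LinearMap.sum_apply, map_smul, map_sum]
      congr 1
      refine (Fintype.sum_equiv (MulAction.toPerm h) _ _ fun q => ?_).symm
      exact (indResCoset_smul φ M h q m).symm)

/-- The counit sends each coset term back to `m`, hence also their average. Thus `M` is a direct
summand of `Ind Res M`. -/
theorem indResSection_comp_indResCounit (φ : G →* H) [φ.range.FiniteIndex] (M : Rep.{0} k H) :
    indResSection φ M ≫ indResCounit φ M = 𝟙 M := by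
  let := Fintype.ofFinite (H ⧸ φ.range)
  ext m
  change (indResCounit φ M).hom.toLinearMap
    (((Fintype.card (H ⧸ φ.range) : k)⁻¹ • ∑ q : H ⧸ φ.range, indResCoset φ M q) m) = m
  have (q : H ⧸ φ.range) :
      (indResCounit φ M).hom.toLinearMap (indResCoset φ M q m) = m := by
    induction q using QuotientGroup.induction_on with
    | H x =>
      rw [indResCoset_mk, IntertwiningMap.toLinearMap_apply, indResCounit_mk,
        ← Module.End.mul_apply, ← map_mul]
      simp
  simp only [LinearMap.smul_apply, LinearMap.sum_apply, map_smul, map_sum, this]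
  rw [Finset.sum_const, Finset.card_univ, ← Nat.cast_smul_eq_nsmul k, smul_smul,
    inv_mul_cancel₀ (Nat.cast_ne_zero.2 Fintype.card_ne_zero), one_smul]

end Rep

/-! ### Finiteness of homology under commensurability -/

open Rep

theorem groupHomology.finite_of_retract {k G : Type} [CommRing k] [Group G] {M M' : Rep.{0} k G}
    (s : M ⟶ M') (p : M' ⟶ M) (h : s ≫ p = 𝟙 M) (i : ℕ)
    [Module.Finite k (groupHomology M' i)] : Module.Finite k (groupHomology M i) := by
  have : Module.Finite k ((groupHomology.functor k G i).obj M') :=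
    inferInstanceAs (Module.Finite k (groupHomology M' i))
  refine Module.Finite.of_surjective ((groupHomology.functor k G i).map p).hom fun x =>
    ⟨((groupHomology.functor k G i).map s).hom x, ?_⟩
  have : (groupHomology.functor k G i).map s ≫ (groupHomology.functor k G i).map p = 𝟙 _ := by
    rw [← Functor.map_comp, h, CategoryTheory.Functor.map_id]
  exact congr($this x)

/-- The homology of `G` up to degree `r` with coefficients in any finite-dimensional complex
representation is finite-dimensional. -/
def HasFiniteHomologyUpTo (G : Type) [Group G] (r : ℕ) : Prop :=
  ∀ (M : Rep.{0} ℂ G) [FiniteDimensional ℂ M], ∀ i ≤ r, FiniteDimensional ℂ (groupHomology M i)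

namespace HasFiniteHomologyUpTo

variable {π G : Type} [Group π] [Group G] {r : ℕ} {f : π →* G}

/-- Shapiro's lemma trades `M` for `Ind M`, which is finite-dimensional by finite index. This is why
the property quantifies over all finite-dimensional coefficients. -/
theorem of_codomain (hf : HasFiniteKernelAndCofiniteImage f) (h : HasFiniteHomologyUpTo G r) :
    HasFiniteHomologyUpTo π r := fun M _ i hi => by
  have := hf.1
  have := hf.2
  have := Representation.finite_indV f M.ρ
  have := h (ind f M) i hi
  exact Module.Finite.equiv (groupHomology.indIsoOfFiniteKer f M i).toLinearEquiv

/-- `M` is a retract of `Ind Res M`, whose homology is that of `Res M` over `π`. -/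
theorem of_domain (hf : HasFiniteKernelAndCofiniteImage f) (h : HasFiniteHomologyUpTo π r) :
    HasFiniteHomologyUpTo G r := fun M _ i hi => by
  have := hf.1
  have := hf.2
  have : FiniteDimensional ℂ (res f M) := inferInstanceAs (FiniteDimensional ℂ M)
  have := h (res f M) i hi
  have := Module.Finite.equiv (groupHomology.indIsoOfFiniteKer f (res f M) i).symm.toLinearEquiv
  exact groupHomology.finite_of_retract _ _ (indResSection_comp_indResCounit f M) i

theorem of_commensurable {G' : Type} [Group G'] (hc : CommensurableUpToFiniteKernels G G')
    (h : HasFiniteHomologyUpTo G' r) : HasFiniteHomologyUpTo G r := by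
  have key (X Y : GrpCat.{0}) (hXY : IsCommensurabilityStep X Y)
      (hY : HasFiniteHomologyUpTo Y r) : HasFiniteHomologyUpTo X r := by
    obtain ⟨π, f, f', hf, hf'⟩ := hXY
    exact of_domain hf (of_codomain hf' hY)
  have (X Y : GrpCat.{0}) (hXY : Relation.TransGen IsCommensurabilityStep X Y) :
      HasFiniteHomologyUpTo Y r → HasFiniteHomologyUpTo X r := by
    induction hXY with
    | single h => exact key _ _ h
    | tail _ h ih => exact fun hY => ih (key _ _ h hY)
  exact this _ _ hc h

end HasFiniteHomologyUpTo

/-! ### Extension of scalars for representations -/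

namespace Rep

open Representation TensorProduct

section BaseChange

variable (k K G : Type) [CommRing k] [CommRing K] [Algebra k K] [Group G]

/-- Extension of scalars of representations. -/
noncomputable def baseChangeFunctor : Rep.{0} k G ⥤ Rep.{0} K G where
  obj V := Rep.of (X := K ⊗[k] V)
    { toFun := fun g => (V.ρ g).baseChange K
      map_one' := by rw [map_one]; exact LinearMap.baseChange_one _ _
      map_mul' := fun g h => by rw [map_mul]; exact LinearMap.baseChange_mul _ _ }
  map f := Rep.ofHom ⟨f.hom.toLinearMap.baseChange K, fun g => by
    change _ ∘ₗ LinearMap.baseChange K _ = LinearMap.baseChange K _ ∘ₗ _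
    rw [← LinearMap.baseChange_comp, ← LinearMap.baseChange_comp, f.hom.2]⟩
  map_id V := by
    ext : 2
    exact LinearMap.baseChange_id
  map_comp f g := by
    ext : 2
    exact LinearMap.baseChange_comp _ _

variable {k G}

theorem baseChangeFunctor_ρ_tmul (V : Rep.{0} k G) (g : G) (c : K) (v : V) :
    ((baseChangeFunctor k K G).obj V).ρ g (c ⊗ₜ v) = c ⊗ₜ V.ρ g v := rfl

variable (k G)

instance : (baseChangeFunctor k K G).Additive where
  map_add {V W f g} := by
    ext : 2
    exact LinearMap.baseChange_add _ _

theorem baseChangeFunctor_map_exact [Module.Flat k K] (S : ShortComplex (Rep.{0} k G))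
    (h : S.Exact) : (S.map (baseChangeFunctor k K G)).Exact := by
  rw [← ShortComplex.exact_map_iff_of_faithful _ (forget₂ (Rep.{0} k G) (ModuleCat.{0} k)),
    ShortComplex.ShortExact.moduleCat_exact_iff_function_exact] at h
  rw [← ShortComplex.exact_map_iff_of_faithful _ (forget₂ (Rep.{0} K G) (ModuleCat.{0} K)),
    ShortComplex.ShortExact.moduleCat_exact_iff_function_exact]
  exact Module.Flat.lTensor_exact K h

theorem baseChangeFunctor_preservesHomology [Module.Flat k K] :
    (baseChangeFunctor k K G).PreservesHomology :=
  ((Functor.exact_tfae _).out 1 2).mp (baseChangeFunctor_map_exact k K G)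

variable {k K G} in
-- Extension of scalars is left adjoint to restriction: lift over `k` by projectivity of `V`, then
-- extend the lift `K`-linearly.
theorem exists_lift_baseChange {V : Rep.{0} k G} [Projective V] {E X : Type}
    [AddCommGroup E] [Module k E] [Module K E] [IsScalarTower k K E]
    [AddCommGroup X] [Module k X] [Module K X] [IsScalarTower k K X]
    (τ : Representation K G E) (σ : Representation K G X) (e : E →ₗ[K] X)
    (he : ∀ g v, e (τ g v) = σ g (e v)) (hsurj : Function.Surjective e)
    (f : K ⊗[k] V →ₗ[K] X) (hf : ∀ g v, f (1 ⊗ₜ V.ρ g v) = σ g (f (1 ⊗ₜ v))) :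
    ∃ L : K ⊗[k] V →ₗ[K] E, e ∘ₗ L = f ∧
      ∀ g, L ∘ₗ (V.ρ g).baseChange K = τ g ∘ₗ L := by
  let τ' : Representation k G E :=
    { toFun := fun g => (τ g).restrictScalars k
      map_one' := by rw [map_one]; rfl
      map_mul' := fun g h => by rw [map_mul]; rfl }
  let σ' : Representation k G X :=
    { toFun := fun g => (σ g).restrictScalars k
      map_one' := by rw [map_one]; rfl
      map_mul' := fun g h => by rw [map_mul]; rfl }
  let e' : Rep.of τ' ⟶ Rep.of σ' := Rep.ofHom
    (LinearMap.intertwiningMap_of_isIntertwiningMap _ _ (e.restrictScalars k) he)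
  let f' : V ⟶ Rep.of σ' := Rep.ofHom
    (LinearMap.intertwiningMap_of_isIntertwiningMap _ _
      ((LinearMap.liftBaseChangeEquiv K).symm f) hf)
  have : Epi e' := (epi_iff_surjective e').2 hsurj
  let l : V ⟶ Rep.of τ' := Projective.factorThru f' e'
  have hl (v : V) : e (l.hom v) = f (1 ⊗ₜ v) := congr($(Projective.factorThru_comp f' e').hom v)
  refine ⟨l.hom.toLinearMap.liftBaseChange K, ?_, fun g => ?_⟩
  · ext v
    simpa using hl v
  · ext v
    simpa using! hom_comm_apply l g v

instance : (baseChangeFunctor k K G).PreservesProjectiveObjects where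
  projective_obj {V} hV := ⟨fun {E X} f e he => by
    let : Module k E := Module.compHom E (algebraMap k K)
    let : Module k X := Module.compHom X (algebraMap k K)
    have : IsScalarTower k K E := IsScalarTower.of_compHom k K E
    have : IsScalarTower k K X := IsScalarTower.of_compHom k K X
    obtain ⟨L, hL, hL'⟩ := exists_lift_baseChange E.ρ X.ρ e.hom.toLinearMap
      (hom_comm_apply e) ((epi_iff_surjective e).1 he) f.hom.toLinearMap
      (fun g v => hom_comm_apply f g (1 ⊗ₜ v))
    refine ⟨Rep.ofHom ⟨L, hL'⟩, ?_⟩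
    ext : 2
    exact hL⟩

/-- Extension of scalars takes the trivial representation to the trivial representation. -/
noncomputable def baseChangeTrivialIso :
    (baseChangeFunctor k K G).obj (Rep.trivial k G k) ≅ Rep.trivial K G K :=
  Rep.mkIso (.mk (TensorProduct.AlgebraTensorModule.rid k K K) fun g => by
    refine LinearMap.ext fun x => ?_
    induction x with
    | zero => simp
    | add x y hx hy => rw [map_add, map_add, hx, hy]
    | tmul c v => rfl)

variable {k K G} in
/-- If the representation `V` is generated by a finite set, then the coinvariants of `M ⊗ V`
are finitely generated for every finitely generated `M`. -/
theorem finite_coinvariantsTensor_baseChange (M : Rep.{0} K G) [Module.Finite K M]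
    (V : Rep.{0} k G) (s : Finset V)
    (hs : ∀ W : Submodule k V, (∀ g, ∀ w ∈ W, V.ρ g w ∈ W) → (s : Set V) ⊆ W → W = ⊤) :
    Module.Finite K (((coinvariantsTensor K G).obj M).obj ((baseChangeFunctor k K G).obj V)) := by
  let T : M →ₗ[K] K ⊗[k] V →ₗ[K]
      ((coinvariantsTensor K G).obj M).obj ((baseChangeFunctor k K G).obj V) :=
    coinvariantsTensorMk M ((baseChangeFunctor k K G).obj V)
  let p := ⨆ x ∈ s, LinearMap.range (T.flip (1 ⊗ₜ x))
  have hT (g : G) (m : M) (y : K ⊗[k] V) :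
      T (M.ρ g m) (((baseChangeFunctor k K G).obj V).ρ g y) = T m y :=
    (Coinvariants.mk_eq_iff _).2 (Coinvariants.mem_ker_of_eq g
      (m ⊗ₜ[K] (show ↑((baseChangeFunctor k K G).obj V) from y)) _ rfl)
  -- `W` is `G`-stable because `m ⊗ gw` and `g⁻¹m ⊗ w` agree in the coinvariants.
  let W : Submodule k V :=
    { carrier := {v | ∀ m, T m (1 ⊗ₜ v) ∈ p}
      zero_mem' := fun m => by simp
      add_mem' := fun {a b} ha hb m => by
        rw [TensorProduct.tmul_add, map_add]
        exact add_mem (ha m) (hb m)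
      smul_mem' := fun c v hv m => by
        have : (1 : K) ⊗ₜ[k] (c • v) = algebraMap k K c • ((1 : K) ⊗ₜ[k] v) := by
          rw [TensorProduct.tmul_smul, algebraMap_smul]
        rw [this, map_smul]
        exact p.smul_mem _ (hv m) }
  have hW : W = ⊤ := by
    refine hs W (fun g w hw m => ?_) fun x hx m => ?_
    · have := hT g (M.ρ g⁻¹ m) (1 ⊗ₜ w)
      rw [← Module.End.mul_apply, ← map_mul, mul_inv_cancel, map_one, Module.End.one_apply,
        baseChangeFunctor_ρ_tmul] at this
      rw [this]
      exact hw _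
    · exact Submodule.mem_iSup_of_mem x (Submodule.mem_iSup_of_mem hx ⟨m, rfl⟩)
  have hp : p = ⊤ := by
    refine eq_top_iff.2 fun z _ => ?_
    obtain ⟨z, rfl⟩ := Coinvariants.mk_surjective _ z
    induction z using TensorProduct.induction_on with
    | zero => simp
    | add a b ha hb => rw [map_add]; exact add_mem (ha Submodule.mem_top) (hb Submodule.mem_top)
    | tmul m y =>
      change T m y ∈ p
      induction y using TensorProduct.induction_on with
      | zero => simp
      | add a b ha hb => rw [map_add]; exact add_mem (ha Submodule.mem_top) (hb Submodule.mem_top)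
      | tmul c v =>
        have hv : v ∈ W := hW ▸ Submodule.mem_top
        have h1 : c ⊗ₜ[k] v = c • ((1 : K) ⊗ₜ[k] v) := by
          rw [TensorProduct.smul_tmul', smul_eq_mul, mul_one]
        rw [h1, map_smul]
        exact p.smul_mem _ (hv m)
  refine ⟨hp ▸ Submodule.fg_biSup s _ fun x _ => ?_⟩
  exact Module.Finite.iff_fg.1 (Module.Finite.range _)

end BaseChange

end Rep

/-! ### Type `FP_r` implies finite homology up to degree `r` -/

/-- Transport of a projective resolution along an isomorphism of the resolved objects. -/
noncomputable def CategoryTheory.ProjectiveResolution.ofTargetIso {C : Type*} [Category* C]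
    [Abelian C] {Z Z' : C} (P : ProjectiveResolution Z) (e : Z ≅ Z') :
    ProjectiveResolution Z' where
  complex := P.complex
  π := P.π ≫ (ChainComplex.single₀ C).map e.hom

open Rep

theorem finite_homology_of_finite_X {k : Type*} [Field k] (C : ChainComplex (ModuleCat k) ℕ)
    (i : ℕ) [FiniteDimensional k (C.X i)] : FiniteDimensional k (C.homology i) := by
  have : FiniteDimensional k (C.cycles i) :=
    Module.Finite.of_injective (C.iCycles i).hom ((ModuleCat.mono_iff_injective _).1 inferInstance)
  exact Module.Finite.of_surjective (C.homologyπ i).hom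
    ((ModuleCat.epi_iff_surjective _).1 inferInstance)

/-- A `G`-stable additive subgroup is a `ℤ[G]`-submodule, so module generators generate `X` as a
representation. -/
theorem finite_coinvariantsTensor_of_finite_module {K G : Type} [CommRing K] [Group G]
    (M : Rep.{0} K G) [Module.Finite K M] (X : ModuleCat.{0} (MonoidAlgebra ℤ G))
    [hX : Module.Finite (MonoidAlgebra ℤ G) X] :
    Module.Finite K (((coinvariantsTensor K G).obj M).obj
      ((baseChangeFunctor ℤ K G).obj (ofModuleMonoidAlgebra.obj X))) := by
  obtain ⟨s, hs⟩ := hX.1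
  refine finite_coinvariantsTensor_baseChange M _ s fun W hW hsW => ?_
  let W' : Submodule (MonoidAlgebra ℤ G) X :=
    { carrier := (W : Set (ofModuleMonoidAlgebra.obj X))
      zero_mem' := W.zero_mem
      add_mem' := W.add_mem
      smul_mem' := fun a x hx => by
        induction a using MonoidAlgebra.induction_on with
        | of g => exact hW g x hx
        | add a b ha hb => rw [add_smul]; exact W.add_mem ha hb
        | smul n a ha =>
          rw [smul_assoc]
          exact W.toAddSubgroup.zsmul_mem ha n }
  have hW' : W' = ⊤ := eq_top_iff.2 (hs ▸ Submodule.span_le.2 hsW)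
  refine eq_top_iff.2 fun x _ => ?_
  have hx : (show X from x) ∈ W' := hW' ▸ Submodule.mem_top
  exact hx

/-- Since `ℂ` is flat over `ℤ`, the resolution stays a projective resolution over `ℂ`; its tensor
product with `M` over `G` is finite-dimensional in degrees `≤ r`. -/
theorem HasFiniteHomologyUpTo.of_isOfTypeFP {G : Type} [Group G] {r : ℕ} (h : IsOfTypeFP G r) :
    HasFiniteHomologyUpTo G r := fun M _ i hi => by
  classical
  obtain ⟨P, hP⟩ := h
  have := baseChangeFunctor_preservesHomology ℤ ℂ G
  have : (ofModuleMonoidAlgebra.{0} (k := ℤ) (G := G)).Additive := ⟨by intros; rfl⟩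
  let e : (baseChangeFunctor ℤ ℂ G).obj (ofModuleMonoidAlgebra.obj (trivialIntModule G)) ≅
      Rep.trivial ℂ G ℂ :=
    (baseChangeFunctor ℤ ℂ G).mapIso
      (equivalenceModuleMonoidAlgebra.unitIso.app (Rep.trivial ℤ G ℤ)).symm ≪≫
    baseChangeTrivialIso ℤ ℂ G
  let Q := ((baseChangeFunctor ℤ ℂ G).mapProjectiveResolution
    (ofModuleMonoidAlgebra.mapProjectiveResolution P)).ofTargetIso e
  have := hP i hi
  have : FiniteDimensional ℂ ((Q.complex.coinvariantsTensorObj M).X i) :=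
    finite_coinvariantsTensor_of_finite_module M (P.complex.X i)
  have := finite_homology_of_finite_X (Q.complex.coinvariantsTensorObj M) i
  exact Module.Finite.equiv (groupHomologyIso M i Q).symm.toLinearEquiv

/-! ### The Wang sequence -/

theorem Finsupp.mapRange_linearMap_sub_smul {α R M N : Type*} [CommRing R] [AddCommGroup M]
    [Module R M] [AddCommGroup N] [Module R N] (f g : M →ₗ[R] N) (c : R) :
    mapRange.linearMap (α := α) (f - c • g) =
      mapRange.linearMap f - c • mapRange.linearMap g := by
  ext : 2
  simp

theorem HomologicalComplex.homologyMap_smul_of_linear {C R ι : Type*} [Category* C]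
    [Preadditive C] [Semiring R] [Linear R C] {c : ComplexShape ι} {K L : HomologicalComplex C c}
    (φ : K ⟶ L) (a : R) (i : ι) [K.HasHomology i] [L.HasHomology i] :
    homologyMap (a • φ) i = a • homologyMap φ i :=
  ShortComplex.homologyMap_smul (S₁ := K.sc i) (S₂ := L.sc i)
    ((shortComplexFunctor C c i).map φ) a

namespace groupHomology

variable {k G : Type} [CommRing k] [Group G] {A B : Rep.{0} k G}

theorem map_id_sub_smul (f g : A ⟶ B) (c : k) (n : ℕ) :
    map (MonoidHom.id G) (f - c • g) n =
      map (MonoidHom.id G) f n - c • map (MonoidHom.id G) g n := by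
  have h : chainsMap (MonoidHom.id G) (f - c • g) =
      chainsMap (MonoidHom.id G) f - c • chainsMap (MonoidHom.id G) g := by
    refine HomologicalComplex.hom_ext _ _ fun i => ModuleCat.hom_ext ?_
    rw [HomologicalComplex.sub_f_apply, HomologicalComplex.smul_f_apply, ModuleCat.hom_sub,
      ModuleCat.hom_smul, chainsMap_id_f_hom_eq_mapRange, chainsMap_id_f_hom_eq_mapRange,
      chainsMap_id_f_hom_eq_mapRange]
    exact Finsupp.mapRange_linearMap_sub_smul f.hom.toLinearMap g.hom.toLinearMap c
  simp only [map]
  rw [h, HomologicalComplex.homologyMap_sub,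
    HomologicalComplex.homologyMap_smul_of_linear]
  rfl

open Rep

/-- If an endomorphism `f` in a short exact sequence `0 → A → A → C → 0` induces isomorphisms on
homology up to degree `r`, then the homology of `C` vanishes up to degree `r`. -/
theorem subsingleton_of_bijective {S : ShortComplex (Rep.{0} k G)} (hS : S.ShortExact) (r : ℕ)
    (hf : ∀ i ≤ r, Function.Bijective (map (MonoidHom.id G) S.f i).hom) (i : ℕ) (hi : i ≤ r) :
    Subsingleton (groupHomology S.X₃ i) := by
  -- Surjectivity of `f` on homology makes `g` zero there, so it suffices that `g` is onto: by right
  -- exactness in degree `0`, and in degree `j + 1` because injectivity of `f` in degree `j` kills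
  -- the connecting map.
  have key (hepi : Function.Surjective (map (MonoidHom.id G) S.g i).hom) :
      Subsingleton (groupHomology S.X₃ i) := by
    refine subsingleton_of_forall_eq 0 fun z => ?_
    obtain ⟨y, rfl⟩ := hepi z
    obtain ⟨x, rfl⟩ := (hf i hi).2 y
    have : map (MonoidHom.id G) S.f i ≫ map (MonoidHom.id G) S.g i = 0 :=
      (mapShortComplex₂ S i).zero
    exact congr($this x)
  apply key
  cases i with
  | zero =>
    have := hS.epi_g
    exact (ModuleCat.epi_iff_surjective _).1 (epi_map_0_of_epi S.g)
  | succ j =>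
    intro z
    have h1 := (ShortComplex.ShortExact.moduleCat_exact_iff_function_exact _).1
      (mapShortComplex₁_exact hS (i := j + 1) rfl)
    have h3 := (ShortComplex.ShortExact.moduleCat_exact_iff_function_exact _).1
      (mapShortComplex₃_exact hS (i := j + 1) rfl)
    refine (h3 z).1 ((hf j (by omega)).1 (Eq.trans ?_ (map_zero _).symm))
    exact (h1 _).2 ⟨z, rfl⟩

end groupHomology

namespace Rep

open Representation

variable {k : Type} [Field k] {G : Type} [Group G]

/-- The twist of a representation by a character. -/
noncomputable abbrev twist (χ : G →* kˣ) (V : Rep.{0} k G) : Rep.{0} k G :=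
  Rep.of (X := V)
    { toFun := fun g => (χ g : k) • V.ρ g
      map_one' := by simp
      map_mul' := fun g h => by
        rw [map_mul, map_mul, Units.val_mul, smul_mul_smul_comm] }

/-- The tensor product of `V` with the permutation representation on `B` on which `G` acts through
left translations by the values of a homomorphism `μ : G →* B`. -/
noncomputable abbrev finsuppTranslate {B : Type} [Group B] (μ : G →* B) (V : Rep.{0} k G) :
    Rep.{0} k G :=
  Rep.of (X := B →₀ V)
    { toFun := fun g => Finsupp.lsum k fun b => Finsupp.lsingle (μ g * b) ∘ₗ V.ρ g
      map_one' := by ext : 3; simp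
      map_mul' := fun g h => by ext : 3; simp [mul_assoc] }

theorem finsuppTranslate_ρ_single {B : Type} [Group B] (μ : G →* B) (V : Rep.{0} k G) (g : G)
    (b : B) (v : V) : (finsuppTranslate μ V).ρ g (Finsupp.single b v) =
      Finsupp.single (μ g * b) (V.ρ g v) := by
  simp

/-- An equivariant linear equivalence is an isomorphism of representations. -/
noncomputable def isoOfLinearEquiv {V W : Rep.{0} k G} (e : V ≃ₗ[k] W)
    (h : ∀ g v, e (V.ρ g v) = W.ρ g (e v)) : V ≅ W :=
  mkIso (.mk e fun g => LinearMap.ext (h g))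

/-- The representation induced from the restriction of `V` to the kernel of a surjective
homomorphism `μ : G → B` is `k[B] ⊗ V`. -/
noncomputable def indIsoFinsuppTranslate {B : Type} [Group B] (μ : G →* B)
    (hμ : Function.Surjective μ) (N : Subgroup G) (hN : N = μ.ker) (V : Rep.{0} k G) :
    ind N.subtype (res N.subtype V) ≅ finsuppTranslate μ V := by
  let s := Function.surjInv hμ
  have hs (b : B) : μ (s b) = b := Function.surjInv_eq hμ b
  let f : ind N.subtype (res N.subtype V) ⟶ finsuppTranslate μ V :=
    (indResHomEquiv.{0} N.subtype _ _).symm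
      (Rep.ofHom (LinearMap.intertwiningMap_of_isIntertwiningMap _ _ (Finsupp.lsingle 1)
        fun g v => by
          have : μ g = 1 := MonoidHom.mem_ker.1 (hN ▸ g.2)
          change _ = (finsuppTranslate μ V).ρ g (Finsupp.single 1 v)
          rw [finsuppTranslate_ρ_single, this, one_mul]
          rfl))
  have hf (h : G) (v : V) :
      f.hom.toLinearMap (IndV.mk N.subtype (res N.subtype V).ρ h v) =
        Finsupp.single (μ h⁻¹) (V.ρ h⁻¹ v) := by
    simp [f]
  -- The choice of section is harmless: two lifts of `b` differ by an element of `N`.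
  let inv : (B →₀ V) →ₗ[k] IndV N.subtype (res N.subtype V).ρ :=
    Finsupp.lsum k fun b => IndV.mk N.subtype (res N.subtype V).ρ (s b)⁻¹ ∘ₗ V.ρ (s b)⁻¹
  have hinv (b : B) (v : V) : inv (Finsupp.single b v) =
      IndV.mk N.subtype (res N.subtype V).ρ (s b)⁻¹ (V.ρ (s b)⁻¹ v) := by
    simp [inv]
  refine isoOfLinearEquiv (LinearEquiv.ofLinearMap f.hom.toLinearMap inv ?_ ?_) fun g v =>
    hom_comm_apply f g v
  · refine Finsupp.lhom_ext fun b v => ?_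
    rw [LinearMap.comp_apply, hinv, hf, inv_inv, hs, ← Module.End.mul_apply, ← map_mul,
      mul_inv_cancel, map_one]
    rfl
  · refine IndV.hom_ext _ _ fun h => LinearMap.ext fun v => ?_
    rw [LinearMap.comp_apply, LinearMap.comp_apply, hf, hinv]
    have hn : (s (μ h⁻¹))⁻¹ * h⁻¹ ∈ N := by
      rw [hN, MonoidHom.mem_ker, map_mul, map_inv, hs, inv_mul_cancel]
    have h1 := IndV.mk_map_mul N.subtype (res N.subtype V).ρ ⟨_, hn⟩ h v
    rw [LinearMap.id_comp, ← h1, ← Module.End.mul_apply, ← map_mul]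
    simp

section Integers

variable (φ : G →* Multiplicative ℤ) (V : Rep.{0} k G)

/-- Translation of the index by one. -/
noncomputable def shift : finsuppTranslate φ V ⟶ finsuppTranslate φ V :=
  Rep.ofHom (LinearMap.intertwiningMap_of_isIntertwiningMap _ _
    (Finsupp.lmapDomain V k (Multiplicative.ofAdd (1 : ℤ) * ·)) fun g x => by
      induction x using Finsupp.induction_linear with
      | zero => simp
      | add x y hx hy => simp only [map_add, hx, hy]
      | single b v => simp [mul_left_comm])

/-- The character of `ℤ` taking the value `c` at the generator. -/
noncomputable def intCharacter (c : kˣ) : Multiplicative ℤ →* kˣ := zpowersHom kˣ c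

theorem intCharacter_apply (c : kˣ) (n : Multiplicative ℤ) :
    intCharacter c n = c ^ n.toAdd := rfl

/-- Evaluation of the index at `c`. -/
noncomputable def evalShift (c : kˣ) :
    finsuppTranslate φ V ⟶ twist ((intCharacter c).comp φ) V :=
  Rep.ofHom (LinearMap.intertwiningMap_of_isIntertwiningMap _ _
    (Finsupp.lsum k fun n => (intCharacter c n : k) • LinearMap.id) fun g x => by
      induction x using Finsupp.induction_linear with
      | zero => simp
      | add x y hx hy => simp only [map_add, hx, hy]
      | single b v => simpa [mul_smul] using smul_comm _ _ _)

theorem evalShift_single (c : kˣ) (n : Multiplicative ℤ) (v : V) :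
    (evalShift φ V c).hom (Finsupp.single n v) = (intCharacter c n : k) • v := by
  change Finsupp.lsum k _ _ = _
  simp

theorem shift_sub_smul_single (c : kˣ) (n : Multiplicative ℤ) (v : V) :
    (shift φ V - (c : k) • 𝟙 _).hom (Finsupp.single n v) =
      Finsupp.single (Multiplicative.ofAdd 1 * n) v - (c : k) • Finsupp.single n v := by
  change Finsupp.lmapDomain V k (Multiplicative.ofAdd (1 : ℤ) * ·) (Finsupp.single n v) -
    (c : k) • Finsupp.single n v = _
  simp

theorem shift_sub_smul_apply (c : kˣ) (x : Multiplicative ℤ →₀ V) (n : Multiplicative ℤ) :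
    (show Multiplicative ℤ →₀ V from (shift φ V - (c : k) • 𝟙 _).hom x)
      (Multiplicative.ofAdd 1 * n) = x n - (c : k) • x (Multiplicative.ofAdd 1 * n) := by
  change (Finsupp.lmapDomain V k (Multiplicative.ofAdd (1 : ℤ) * ·) x - (c : k) • x) _ = _
  rw [Finsupp.sub_apply, Finsupp.smul_apply, Finsupp.lmapDomain_apply,
    Finsupp.mapDomain_apply (mul_right_injective _)]

/-- The short complex `k[ℤ] ⊗ V → k[ℤ] ⊗ V → V_c` whose long exact homology sequence is the Wang
sequence. -/
noncomputable def wangComplex (c : kˣ) : ShortComplex (Rep.{0} k G) where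
  X₁ := finsuppTranslate φ V
  X₂ := finsuppTranslate φ V
  X₃ := twist ((intCharacter c).comp φ) V
  f := shift φ V - (c : k) • 𝟙 _
  g := evalShift φ V c
  zero := by
    ext : 2
    refine Finsupp.lhom_ext fun n v => ?_
    change (evalShift φ V c).hom.toLinearMap ((shift φ V - (c : k) • 𝟙 _).hom _) = 0
    rw [shift_sub_smul_single, map_sub, map_smul]
    simp only [IntertwiningMap.toLinearMap_apply]
    rw [evalShift_single, evalShift_single, smul_smul, map_mul, Units.val_mul]
    simp [intCharacter_apply]

theorem wangComplex_shortExact (c : kˣ) : (wangComplex φ V c).ShortExact where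
  exact := by
    rw [← ShortComplex.exact_map_iff_of_faithful _ (forget₂ (Rep.{0} k G) (ModuleCat.{0} k)),
      ShortComplex.moduleCat_exact_iff]
    intro x hx
    let D : (Multiplicative ℤ →₀ V) →ₗ[k] (Multiplicative ℤ →₀ V) :=
      (shift φ V - (c : k) • 𝟙 _).hom.toLinearMap
    let q : (Multiplicative ℤ →₀ V) →ₗ[k] V := (evalShift φ V c).hom.toLinearMap
    have hq (n : Multiplicative ℤ) (v : V) :
        q (Finsupp.single n v) = (c ^ n.toAdd : kˣ) • v := evalShift_single φ V c n v
    have hD (n : ℤ) (v : V) : D (Finsupp.single (Multiplicative.ofAdd n) v) =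
        Finsupp.single (Multiplicative.ofAdd (n + 1)) v -
          c • Finsupp.single (Multiplicative.ofAdd n) v := by
      rw [add_comm n 1]
      exact shift_sub_smul_single φ V c (Multiplicative.ofAdd n) v
    have hmem (n : ℤ) (v : V) : Finsupp.single (Multiplicative.ofAdd (n + 1)) v -
        c • Finsupp.single (Multiplicative.ofAdd n) v ∈ LinearMap.range D := ⟨_, hD n v⟩
    have hsingle (n : ℤ) (v : V) : Finsupp.single (Multiplicative.ofAdd n) v -
        Finsupp.single 1 ((c ^ n : kˣ) • v) ∈ LinearMap.range D := by
      induction n generalizing v with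
      | zero => simp
      | succ n ih =>
        have h1 := add_mem (hmem n v) (ih (c • v))
        rwa [← Finsupp.smul_single, sub_add_sub_cancel, smul_smul, ← zpow_add_one] at h1
      | pred n ih =>
        have h1 := sub_mem (ih (c⁻¹ • v)) (hmem (-n - 1) (c⁻¹ • v))
        rwa [sub_add_cancel, Finsupp.smul_single, smul_inv_smul, sub_sub_sub_cancel_left,
          smul_smul, ← zpow_sub_one] at h1
    -- Modulo the image of `t - c`, every element is concentrated at the identity of `ℤ`, with value
    -- its evaluation at `c`.
    have hall (y : Multiplicative ℤ →₀ V) : y - Finsupp.single 1 (q y) ∈ LinearMap.range D := by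
      induction y using Finsupp.induction_linear with
      | zero => simp
      | add y z hy hz =>
        rw [map_add, Finsupp.single_add, add_sub_add_comm]
        exact add_mem hy hz
      | single n v => rw [hq]; exact hsingle n.toAdd v
    have hx' : q x = 0 := hx
    obtain ⟨y, hy⟩ := hall x
    rw [hx', Finsupp.single_zero] at hy
    exact ⟨y, hy.trans (sub_zero (show Multiplicative ℤ →₀ V from x))⟩
  mono_f := (mono_iff_injective _).2 <| by
    let D : (Multiplicative ℤ →₀ V) →ₗ[k] (Multiplicative ℤ →₀ V) :=
      (shift φ V - (c : k) • 𝟙 _).hom.toLinearMap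
    refine (injective_iff_map_eq_zero D).2 fun x hx => ?_
    by_contra hne
    -- At the lowest index `n` of the support, `(t - c)x` has coefficient `-c • x n`, which is
    -- nonzero.
    obtain ⟨n, hn, hmin⟩ := x.support.exists_min_image Multiplicative.toAdd
      (Finsupp.support_nonempty_iff.2 hne)
    let m : Multiplicative ℤ := Multiplicative.ofAdd (n.toAdd - 1)
    have hm : Multiplicative.ofAdd 1 * m = n := by
      rw [← ofAdd_add]; simp
    have h1 := shift_sub_smul_apply φ V c x m
    have h2 : x m = 0 := by
      by_contra h
      have := hmin m (Finsupp.mem_support_iff.2 h)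
      simp [m] at this
    have h3 : (0 : V) = x m - (c : k) • x (Multiplicative.ofAdd 1 * m) := by
      rw [← h1]
      exact congr($(hx.symm) _)
    rw [h2, hm, zero_sub, eq_comm, neg_eq_zero, smul_eq_zero] at h3
    exact h3.elim c.ne_zero (Finsupp.mem_support_iff.1 hn)
  epi_g := (epi_iff_surjective _).2 fun v => ⟨Finsupp.single 1 v, by
    refine (evalShift_single φ V c 1 v).trans ?_
    rw [map_one, Units.val_one]
    exact one_smul k (show V from v)⟩

end Integers

end Rep

/-! ### Twists with vanishing homology -/

open Rep

theorem Module.End.exists_ne_zero_forall_bijective_sub_smul {k : Type*} [Field k] [Infinite k]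
    (r : ℕ) (H : ℕ → Type*) [∀ i, AddCommGroup (H i)] [∀ i, Module k (H i)]
    (hH : ∀ i ≤ r, FiniteDimensional k (H i)) (T : ∀ i, Module.End k (H i)) :
    ∃ c : kˣ, ∀ i ≤ r, Function.Bijective (T i - (c : k) • (LinearMap.id : H i →ₗ[k] H i)) := by
  have hfin : (⋃ i ∈ Set.Iic r, {c : k | (T i).HasEigenvalue c}).Finite :=
    (Set.finite_Iic r).biUnion fun i hi =>
      have := hH i hi
      (T i).finite_hasEigenvalue
  -- Zero is excluded as well, so that `c` defines a character of `ℤ`.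
  obtain ⟨c, hc⟩ := (hfin.insert 0).infinite_compl.nonempty
  simp only [Set.mem_compl_iff, Set.mem_insert_iff, Set.mem_iUnion, not_or, not_exists] at hc
  refine ⟨Units.mk0 c hc.1, fun i hi => ?_⟩
  have := hH i hi
  have hinj : Function.Injective (T i - c • (LinearMap.id : H i →ₗ[k] H i)) := by
    have h1 : ¬ (T i).HasEigenvalue c := hc.2 i hi
    rw [Module.End.hasEigenvalue_iff, not_not, Module.End.eigenspace_def] at h1
    exact LinearMap.ker_eq_bot.1 h1
  exact ⟨hinj, LinearMap.injective_iff_surjective.1 hinj⟩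

namespace Rep

variable {k : Type} [Field k] {G : Type} [Group G]

theorem exists_acyclic_twist_int [Infinite k] (φ : G →* Multiplicative ℤ) (V : Rep.{0} k G)
    (r : ℕ) (h : ∀ i ≤ r, FiniteDimensional k (groupHomology (finsuppTranslate φ V) i)) :
    ∃ c : kˣ, ∀ i ≤ r,
      Subsingleton (groupHomology (twist ((intCharacter c).comp φ) V) i) := by
  obtain ⟨c, hc⟩ := Module.End.exists_ne_zero_forall_bijective_sub_smul r
    (fun i => groupHomology (finsuppTranslate φ V) i) h
    fun i => (groupHomology.map (MonoidHom.id G) (shift φ V) i).hom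
  refine ⟨c, groupHomology.subsingleton_of_bijective (wangComplex_shortExact φ V c) r
    fun i hi => ?_⟩
  have h1 := groupHomology.map_id_sub_smul (shift φ V) (𝟙 _) (c : k) i
  rw [groupHomology.map_id] at h1
  exact cast (congrArg (fun f => Function.Bijective f.hom) h1).symm (hc i hi)

theorem subsingleton_groupHomology_of_iso {V W : Rep.{0} k G} (e : V ≅ W) (i : ℕ)
    [h : Subsingleton (groupHomology V i)] : Subsingleton (groupHomology W i) :=
  have : Subsingleton ((groupHomology.functor k G i).obj V) := h
  ((groupHomology.functor k G i).mapIso e).toLinearEquiv.symm.injective.subsingleton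

theorem finite_groupHomology_of_iso {V W : Rep.{0} k G} (e : V ≅ W) (i : ℕ)
    (h : FiniteDimensional k (groupHomology V i)) : FiniteDimensional k (groupHomology W i) :=
  have : Module.Finite k ((groupHomology.functor k G i).obj V) := h
  Module.Finite.equiv ((groupHomology.functor k G i).mapIso e).toLinearEquiv

/-- Every homomorphism `μ : G → B` and representation `V` of `G` for which the homology with
coefficients in `k[B] ⊗ V` is finite-dimensional up to degree `r` admit a character of `B` such
that the homology of the twist of `V` vanishes up to degree `r`. -/
def HasAcyclicTwists (k : Type) [Field k] (B : Type) [Group B] : Prop :=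
  ∀ (G : Type) [Group G] (μ : G →* B) (V : Rep.{0} k G) (r : ℕ),
    (∀ i ≤ r, FiniteDimensional k (groupHomology (finsuppTranslate μ V) i)) →
      ∃ χ : B →* kˣ, ∀ i ≤ r, Subsingleton (groupHomology (twist (χ.comp μ) V) i)

namespace HasAcyclicTwists

theorem int [Infinite k] : HasAcyclicTwists k (Multiplicative ℤ) := fun _ _ φ V r h =>
  have ⟨c, hc⟩ := exists_acyclic_twist_int φ V r h
  ⟨intCharacter c, hc⟩

variable {B B' : Type} [Group B] [Group B']

theorem of_mulEquiv (e : B ≃* B') (h : HasAcyclicTwists k B) : HasAcyclicTwists k B' :=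
  fun G _ μ V r hfin => by
    have i : finsuppTranslate μ V ≅ finsuppTranslate (e.symm.toMonoidHom.comp μ) V :=
      isoOfLinearEquiv (Finsupp.domLCongr e.symm.toEquiv) fun g x => by
        induction x using Finsupp.induction_linear with
        | zero => simp only [map_zero]
        | add x y hx hy => simp only [map_add, hx, hy]
        | single b v => simp
    obtain ⟨χ, hχ⟩ := h G (e.symm.toMonoidHom.comp μ) V r fun n hn =>
      finite_groupHomology_of_iso i n (hfin n hn)
    exact ⟨χ.comp e.symm.toMonoidHom, hχ⟩

/-- Use `k[B × B'] ⊗ V ≅ k[B] ⊗ (k[B'] ⊗ V)`. After a twist by a character of `B`, the homology of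
`k[B'] ⊗ V` vanishes up to degree `r`; it is then finite-dimensional, so the hypothesis on `B'`
applies to the twisted `V`. -/
theorem prod {B B' : Type} [Group B] [CommGroup B'] (h : HasAcyclicTwists k B)
    (h' : HasAcyclicTwists k B') : HasAcyclicTwists k (B × B') := fun G _ μ V r hfin => by
  let μ₁ := (MonoidHom.fst B B').comp μ
  let μ₂ := (MonoidHom.snd B B').comp μ
  have e : finsuppTranslate μ V ≅ finsuppTranslate μ₁ (finsuppTranslate μ₂ V) :=
    isoOfLinearEquiv (Finsupp.curryLinearEquiv k) fun g x => by
      induction x using Finsupp.induction_linear with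
      | zero => simp only [map_zero]
      | add x y hx hy => simp only [map_add, hx, hy]
      | single b v => simp [μ₁, μ₂]
  obtain ⟨χ, hχ⟩ := h G μ₁ (finsuppTranslate μ₂ V) r fun n hn =>
    finite_groupHomology_of_iso e n (hfin n hn)
  have e₂ : twist (χ.comp μ₁) (finsuppTranslate μ₂ V) ≅
      finsuppTranslate μ₂ (twist (χ.comp μ₁) V) :=
    isoOfLinearEquiv (LinearEquiv.refl k (B' →₀ V)) fun g x => by
      induction x using Finsupp.induction_linear with
      | zero => simp only [map_zero]
      | add x y hx hy => simp only [map_add, hx, hy]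
      | single b v => simp
  obtain ⟨χ', hχ'⟩ := h' G μ₂ (twist (χ.comp μ₁) V) r fun n hn => by
    have := hχ n hn
    have := subsingleton_groupHomology_of_iso e₂ n
    infer_instance
  refine ⟨χ.coprod χ', fun n hn => ?_⟩
  have e₃ : twist (χ'.comp μ₂) (twist (χ.comp μ₁) V) ≅ twist ((χ.coprod χ').comp μ) V :=
    isoOfLinearEquiv (LinearEquiv.refl k V) fun g v => by
      simp [μ₁, μ₂, smul_smul, mul_comm]
  have := hχ' n hn
  exact subsingleton_groupHomology_of_iso e₃ n

/-- The exponent must be positive: the trivial group offers no non-trivial twist, and the claim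
fails for it. -/
theorem int_pow [Infinite k] (n : ℕ) :
    HasAcyclicTwists k (Multiplicative (Fin (n + 1) → ℤ)) := by
  induction n with
  | zero =>
    exact int.of_mulEquiv (LinearEquiv.funUnique (Fin 1) ℤ ℤ).symm.toAddEquiv.toMultiplicative
  | succ n ih =>
    exact (int.prod ih).of_mulEquiv ((MulEquiv.prodMultiplicative _ _).symm.trans
      (Fin.consLinearEquiv ℤ fun _ : Fin (n + 2) => ℤ).toAddEquiv.toMultiplicative)

end HasAcyclicTwists

end Rep

/-! ### Homology of the kernel and the main theorem -/

theorem Group.FG.exists_mulEquiv_int_pow {B : Type*} [CommGroup B] [Group.FG B]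
    [IsMulTorsionFree B] [Nontrivial B] :
    ∃ n : ℕ, Nonempty (B ≃* Multiplicative (Fin (n + 1) → ℤ)) := by
  have : Module.Finite ℤ (Additive B) := Module.Finite.iff_addGroup_fg.2 inferInstance
  have : Module.IsTorsionFree ℤ (Additive B) := inferInstance
  let b := Module.finBasis ℤ (Additive B)
  obtain ⟨n, hn⟩ := Nat.exists_eq_add_one_of_ne_zero
    (Module.finrank_pos (R := ℤ) (M := Additive B)).ne'
  let e : Additive B ≃+ (Fin (n + 1) → ℤ) :=
    (b.reindex (finCongr hn)).equivFun.toAddEquiv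
  exact ⟨n, ⟨AddEquiv.toMultiplicativeRight e⟩⟩

section Kernel

variable {G : Type} [Group G] {A : Type*} [CommGroup A] [IsMulTorsionFree A]

/-- If the homology of the kernel of a non-trivial homomorphism to a torsion-free abelian group
is finite-dimensional up to degree `r`, then some character of `G` has vanishing homology up to
degree `r`. -/
theorem exists_character_of_finite_homology_ker [Group.FG G] (ν : G →* A) (hν : ν ≠ 1) (r : ℕ)
    (h : ∀ i ≤ r, FiniteDimensional ℂ (groupHomology (Rep.trivial ℂ ν.ker ℂ) i)) :
    ∃ ρ : G →* ℂˣ, ∀ i ≤ r, Subsingleton (groupHomology (characterRep ρ) i) := by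
  classical
  have : Nontrivial ν.range := by
    rw [Subgroup.nontrivial_iff_ne_bot]
    exact fun h0 => hν (MonoidHom.range_eq_bot_iff.1 h0)
  have : Group.FG ν.range := Group.fg_of_surjective ν.rangeRestrict_surjective
  obtain ⟨n, ⟨e⟩⟩ := Group.FG.exists_mulEquiv_int_pow (B := ν.range)
  let μ : G →* Multiplicative (Fin (n + 1) → ℤ) := e.toMonoidHom.comp ν.rangeRestrict
  have hμ : Function.Surjective μ := e.surjective.comp ν.rangeRestrict_surjective
  have hker : ν.ker = μ.ker := by
    ext g
    simp [μ, MonoidHom.mem_ker]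
  obtain ⟨χ, hχ⟩ := HasAcyclicTwists.int_pow n G μ (Rep.trivial ℂ G ℂ) r fun i hi => by
    refine finite_groupHomology_of_iso (indIsoFinsuppTranslate μ hμ ν.ker hker _) i ?_
    have := h i hi
    exact Module.Finite.equiv
      (groupHomology.indIso ν.ker (Rep.trivial ℂ ν.ker ℂ) i).symm.toLinearEquiv
  -- The twist of the trivial representation by `ρ` is `ℂ_ρ` by definition.
  exact ⟨χ.comp μ, hχ⟩

end Kernel

theorem theorem1p2 {G : Type} [Group G] [Group.FG G]
    {A : Type*} [CommGroup A] [IsMulTorsionFree A]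
    (ν : G →* A) (hν : ν ≠ 1)
    (r : ℕ) (hr : 1 ≤ r)
    (hV : characteristicVariety G r 1 = Set.univ) :
    ¬ FiniteDimensional ℂ (homologyUpTo ν.ker r) ∧
      ∀ (G' : Type) [Group G'],
        CommensurableUpToFiniteKernels ν.ker G' → ¬ IsOfTypeFP G' r := by
  -- Both claims follow from this: each negated conclusion would make all these spaces
  -- finite-dimensional.
  have key : ¬ ∀ i ≤ r, FiniteDimensional ℂ (groupHomology (Rep.trivial ℂ ν.ker ℂ) i) := by
    intro h
    obtain ⟨ρ, hρ⟩ := exists_character_of_finite_homology_ker ν hν r h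
    have hmem : ρ ∈ characteristicVariety G r 1 := hV ▸ Set.mem_univ ρ
    have := hρ r le_rfl
    have hle : ((1 : ℕ) : Cardinal) ≤ Module.rank ℂ (groupHomology (characterRep ρ) r) := hmem
    rw [rank_subsingleton', Nat.cast_one] at hle
    exact absurd hle (by simp)
  refine ⟨fun hfin => key fun i hi => ?_, fun G' _ hc hFP => key fun i hi => ?_⟩
  · exact Module.Finite.of_surjective
      (DirectSum.component ℂ (Fin (r + 1))
        (fun j => groupHomology (Rep.trivial ℂ ν.ker ℂ) (j : ℕ)) ⟨i, Nat.lt_succ_of_le hi⟩)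
      fun x => ⟨DirectSum.lof ℂ (Fin (r + 1))
        (fun j => groupHomology (Rep.trivial ℂ ν.ker ℂ) (j : ℕ)) ⟨i, Nat.lt_succ_of_le hi⟩ x,
        DirectSum.component.lof_self ..⟩
  · have : FiniteDimensional ℂ (Rep.trivial ℂ ν.ker ℂ) :=
      inferInstanceAs (FiniteDimensional ℂ ℂ)
    exact (HasFiniteHomologyUpTo.of_isOfTypeFP hFP).of_commensurable hc _ i hi
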